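/- For an ordinal $\alpha$, $\mathsf{PEA}_\alpha$ is the class of polyadic equality algebras of dimension $\alpha$: Boolean algebras $A$ with operators $\mathsf c_{(\Gamma)}$ ($\Gamma\subseteq\alpha$), $\mathsf s_\tau$ ($\tau\in{}^{\alpha}\alpha$) and constants $\mathsf d_{ij}$ ($i,j<\alpha$) such that, for all $\Gamma,\Delta\subseteq\alpha$, $\sigma,\tau\in{}^\alpha\alpha$, $i,j<\alpha$ and $x,y\in A$: $\mathsf c_{(\Gamma)}0=0$; $x\le \mathsf c_{(\Gamma)}x$; $\mathsf c_{(\Gamma)}(x\cdot \mathsf c_{(\Gamma)}y)=\mathsf c_{(\Gamma)}x\cdot \mathsf c_{(\Gamma)}y$; $\mathsf c_{(\emptyset)}x=x$; $\mathsf c_{(\Gamma)}\mathsf c_{(\Delta)}x=\mathsf c_{(\Gamma\cup\Delta)}x$; $\mathsf s_\tau$ is a Boolean endomorphism; $\mathsf s_{\mathrm{Id}}x=x$; $\mathsf s_{\sigma\circ\tau}x=\mathsf s_\sigma \mathsf s_\tau x$; $\mathsf s_\sigma \mathsf c_{(\Gamma)}x=\mathsf s_\tau \mathsf c_{(\Gamma)}x$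 if $\sigma$ and $\tau$ agree off $\Gamma$; $\mathsf c_{(\Gamma)}\mathsf s_\tau x=\mathsf s_\tau \mathsf c_{(\tau^{-1}\Gamma)}x$ if $\tau$ is one-to-one on $\tau^{-1}\Gamma$; $\mathsf d_{ii}=1$; $x\cdot \mathsf d_{ij}\le \mathsf s_{[i/j]}x$, where $[i/j]$ sends $i$ to $j$ and fixes all other indices; $\mathsf s_\tau \mathsf d_{ij}=\mathsf d_{\tau(i)\tau(j)}$. For $\alpha\le\beta$ and $\mathfrak B\in\mathsf{PEA}_\beta$, the neat $\alpha$-reduct $\mathfrak{Nr}_\alpha\mathfrak B\in\mathsf{PEA}_\alpha$ has universe $\{b\in B:\mathsf c_{(\beta\setminus\alpha)}b=b\}$, with the Boolean operations, $\mathsf c_{(\Gamma)}$ for $\Gamma\subseteq\alpha$ and $\mathsf d_{ij}$ for $i,j<\alpha$ inherited from $\mathfrak B$, and with $\mathsf s_\tau$ for $\tau\in{}^\alpha\alpha$ computed as $\mathsf s^{\mathfrak B}_{\bar\tau}$, where $\bar\tau\in{}^\beta\beta$ extends $\tau$ by the identity on $\beta\setminus\alpha$. An ideal is a Boolean ideal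 closed under all $\mathsf c_{(\Gamma)}$ and $\mathsf s_\tau$. An algebra is simple if it has more than one element and its only ideals are $\{0\}$ and the whole algebra. **Lemma.** Let $\alpha$ be an infinite ordinal, $\beta>\alpha$ an ordinal, and $\mathfrak A\in\mathsf{PEA}_\alpha$. (1) There exist $\mathfrak B\in\mathsf{PEA}_\beta$ and an embedding of $\mathfrak A$ into $\mathfrak{Nr}_\alpha\mathfrak B$ such that, identifying $\mathfrak A$ with its image, every element of $\mathfrak B$ has the form $\mathsf s^{\mathfrak B}_\sigma a$ with $a\in A$ and $\sigma\in{}^\beta\beta$ such that $\sigma\upharpoonright\alpha$ is one-to-one. (2) Let $\mathfrak B\in\mathsf{PEA}_\beta$ be any algebra such that $\mathfrak A$ embeds as a subalgebra in $\mathfrak{Nr}_\alpha\mathfrak B$ and $A$ generates $\mathfrak B$ (no proper subalgebra of $\mathfrak B$ contains $A$). If $\mathfrak A$ is simple, then $\mathfrak B$ is simple. Moreover (whether or not $\mathfrak A$ is simple), every ideal $I$ of $\mathfrak B$ is the ideal of $\mathfrak B$ generated by $I\cap A$. -/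

import Mathlib

open Set Function
open scoped Ordinal

universe u v w

section PolyadicDefinitions

/-- The replacement `[i/j]`: it sends `i` to `j` and fixes every other index. -/
noncomputable def replacement {ι : Type u} (i j : ι) : ι → ι :=
  open Classical in fun k => if k = i then j else k

/-- Polyadic algebras with index set (dimension) `ι`: a Boolean algebra `A` with cylindrifications
`c_(Γ)` for all `Γ ⊆ ι` and substitutions `s_τ` for all `τ : ι → ι`, subject to the polyadic
axioms. -/
class PolyadicAlgebra (ι : Type u) (A : Type v) [BooleanAlgebra A] where
  /-- the cylindrification `c_(Γ)` -/
  cyl : Set ι → A → A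
  /-- the substitution `s_τ` -/
  subst : (ι → ι) → A → A
  cyl_bot : ∀ Γ, cyl Γ ⊥ = ⊥
  le_cyl : ∀ Γ x, x ≤ cyl Γ x
  cyl_inf_cyl : ∀ Γ x y, cyl Γ (x ⊓ cyl Γ y) = cyl Γ x ⊓ cyl Γ y
  cyl_empty : ∀ x, cyl ∅ x = x
  cyl_cyl : ∀ Γ Δ x, cyl Γ (cyl Δ x) = cyl (Γ ∪ Δ) x
  subst_sup : ∀ τ x y, subst τ (x ⊔ y) = subst τ x ⊔ subst τ y
  subst_compl : ∀ τ x, subst τ xᶜ = (subst τ x)ᶜ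
  subst_id : ∀ x, subst id x = x
  subst_comp : ∀ σ τ x, subst (σ ∘ τ) x = subst σ (subst τ x)
  subst_cyl_congr : ∀ Γ σ τ x, (∀ i, i ∉ Γ → σ i = τ i) →
    subst σ (cyl Γ x) = subst τ (cyl Γ x)
  cyl_subst : ∀ Γ τ x, InjOn τ (τ ⁻¹' Γ) → cyl Γ (subst τ x) = subst τ (cyl (τ ⁻¹' Γ) x)

/-- Polyadic equality algebras: polyadic algebras with diagonal elements `d_ij`. -/
class PolyadicEqualityAlgebra (ι : Type u) (A : Type v) [BooleanAlgebra A] extends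
    PolyadicAlgebra ι A where
  /-- the diagonal element `d_ij` -/
  diag : ι → ι → A
  diag_self : ∀ i, diag i i = ⊤
  inf_diag_le : ∀ i j x, x ⊓ diag i j ≤ subst (replacement i j) x
  subst_diag : ∀ τ i j, subst τ (diag i j) = diag (τ i) (τ j)

open PolyadicAlgebra PolyadicEqualityAlgebra

/-- Homomorphisms of polyadic equality algebras. -/
structure PolyadicEqualityHom (ι : Type u) (A : Type v) (B : Type w)
    [BooleanAlgebra A] [BooleanAlgebra B]
    [PolyadicEqualityAlgebra ι A] [PolyadicEqualityAlgebra ι B] extends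
    BoundedLatticeHom A B where
  map_cyl : ∀ (Γ : Set ι) (x : A), toFun (cyl Γ x) = cyl Γ (toFun x)
  map_subst : ∀ (τ : ι → ι) (x : A), toFun (subst τ x) = subst τ (toFun x)
  map_diag : ∀ i j : ι, toFun (diag i j) = diag i j

instance (ι : Type u) (A : Type v) (B : Type w)
    [BooleanAlgebra A] [BooleanAlgebra B]
    [PolyadicEqualityAlgebra ι A] [PolyadicEqualityAlgebra ι B] :
    CoeFun (PolyadicEqualityHom ι A B) (fun _ => A → B) where
  coe f := f.toFun

/-- Subalgebras: Boolean subalgebras closed under all cylindrifications and substitutions and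
containing all diagonal elements. -/
structure IsPolyadicEqualitySubalgebra (ι : Type u) {B : Type v} [BooleanAlgebra B]
    [PolyadicEqualityAlgebra ι B] (S : BooleanSubalgebra B) : Prop where
  cyl_mem : ∀ (Γ : Set ι) (x : B), x ∈ S → cyl Γ x ∈ S
  subst_mem : ∀ (τ : ι → ι) (x : B), x ∈ S → subst τ x ∈ S
  diag_mem : ∀ i j : ι, (diag i j : B) ∈ S

/-- `X` generates `B`: the only subalgebra of `B` containing `X` is `B` itself. -/
def PolyadicGenerates (ι : Type u) {B : Type v} [BooleanAlgebra B]
    [PolyadicEqualityAlgebra ι B] (X : Set B) : Prop :=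
  ∀ S : BooleanSubalgebra B, IsPolyadicEqualitySubalgebra ι S → X ⊆ S → ∀ b : B, b ∈ S

/-- Ideals of a polyadic (equality) algebra: Boolean ideals closed under all cylindrifications and
substitutions. -/
structure IsPolyadicIdeal (ι : Type u) {B : Type v} [BooleanAlgebra B] [PolyadicAlgebra ι B]
    (I : Order.Ideal B) : Prop where
  cyl_mem : ∀ (Γ : Set ι) (x : B), x ∈ I → cyl Γ x ∈ I
  subst_mem : ∀ (τ : ι → ι) (x : B), x ∈ I → subst τ x ∈ I

/-- The ideal generated by a set `X`: the intersection of all ideals that contain `X`. -/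
noncomputable def polyadicIdealGenerated (ι : Type u) {B : Type v} [BooleanAlgebra B]
    [PolyadicAlgebra ι B] (X : Set B) : Order.Ideal B :=
  sInf {I : Order.Ideal B | IsPolyadicIdeal ι I ∧ X ⊆ (I : Set B)}

/-- Simple algebras: those with more than one element in which `{0}` and the whole algebra are
the only ideals. -/
def IsPolyadicSimple (ι : Type u) (B : Type v) [BooleanAlgebra B] [PolyadicAlgebra ι B] : Prop :=
  Nontrivial B ∧ ∀ I : Order.Ideal B, IsPolyadicIdeal ι I → I = ⊥ ∨ I = ⊤

/-! ### Compressions and neat reducts -/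

/-- For `e : ι ↪ κ`, the extension of `τ : ι → ι` to `κ`: it acts as `τ` on the copy of `ι` in `κ`
and as the identity off it. -/
noncomputable def extendMap {ι : Type u} {κ : Type w} (e : ι ↪ κ) (τ : ι → ι) : κ → κ :=
  Function.extend e (e ∘ τ) id

section
variable {ι : Type u} {κ : Type w} (e : ι ↪ κ)

theorem extendMap_apply (τ : ι → ι) (i : ι) : extendMap e τ (e i) = e (τ i) :=
  e.injective.extend_apply _ _ i

theorem extendMap_of_notMem (τ : ι → ι) {k : κ} (hk : k ∉ range e) : extendMap e τ k = k :=
  Function.extend_apply' _ _ k (fun ⟨a, ha⟩ => hk ⟨a, ha⟩)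

theorem extendMap_mem_range_iff (τ : ι → ι) (k : κ) :
    extendMap e τ k ∈ range e ↔ k ∈ range e := by
  by_cases hk : k ∈ range e
  · obtain ⟨i, rfl⟩ := hk
    simp [extendMap_apply]
  · rw [extendMap_of_notMem e τ hk]

theorem extendMap_preimage_compl (τ : ι → ι) :
    extendMap e τ ⁻¹' (range e)ᶜ = (range e)ᶜ := by
  ext k
  simpa using (extendMap_mem_range_iff e τ k).not

theorem extendMap_id : extendMap e id = id := by
  ext k
  by_cases hk : k ∈ range e
  · obtain ⟨i, rfl⟩ := hk
    simp [extendMap_apply]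
  · simp [extendMap_of_notMem e id hk]

theorem extendMap_comp (σ τ : ι → ι) : extendMap e (σ ∘ τ) = extendMap e σ ∘ extendMap e τ := by
  ext k
  by_cases hk : k ∈ range e
  · obtain ⟨i, rfl⟩ := hk
    simp [extendMap_apply]
  · simp [extendMap_of_notMem e _ hk]

theorem extendMap_preimage_image (τ : ι → ι) (Γ : Set ι) :
    extendMap e τ ⁻¹' (e '' Γ) = e '' (τ ⁻¹' Γ) := by
  ext k
  by_cases hk : k ∈ range e
  · obtain ⟨i, rfl⟩ := hk
    simp [extendMap_apply]
  · have h1 : k ∉ e '' Γ := fun h => hk (image_subset_range _ _ h)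
    have h2 : k ∉ e '' (τ ⁻¹' Γ) := fun h => hk (image_subset_range _ _ h)
    simp only [mem_preimage, extendMap_of_notMem e τ hk, h1, h2]

theorem extendMap_replacement (i j : ι) :
    extendMap e (replacement i j) = replacement (e i) (e j) := by
  ext k
  by_cases hk : k ∈ range e
  · obtain ⟨l, rfl⟩ := hk
    rw [extendMap_apply]
    by_cases h : l = i <;> simp [replacement, h]
  · have h : k ≠ e i := fun h => hk ⟨i, h.symm⟩
    rw [extendMap_of_notMem e _ hk]
    simp [replacement, h]

end

section
variable {κ : Type w} {B : Type v} [BooleanAlgebra B] [PolyadicAlgebra κ B]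

theorem polyadic_cyl_inf_of_fixed {Γ : Set κ} {x y : B} (hx : cyl Γ x = x) (hy : cyl Γ y = y) :
    cyl Γ (x ⊓ y) = x ⊓ y := by
  conv_lhs => rw [← hy]
  rw [cyl_inf_cyl, hx, hy]

theorem polyadic_cyl_compl_of_fixed {Γ : Set κ} {x : B} (hx : cyl Γ x = x) :
    cyl Γ xᶜ = xᶜ := by
  refine le_antisymm ?_ (le_cyl _ _)
  rw [le_compl_iff_disjoint_right, disjoint_iff]
  conv_lhs => rw [← hx]
  rw [← cyl_inf_cyl, hx, compl_inf_eq_bot, cyl_bot]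

theorem polyadic_cyl_sup_of_fixed {Γ : Set κ} {x y : B} (hx : cyl Γ x = x) (hy : cyl Γ y = y) :
    cyl Γ (x ⊔ y) = x ⊔ y := by
  have := polyadic_cyl_compl_of_fixed (polyadic_cyl_inf_of_fixed
    (polyadic_cyl_compl_of_fixed hx) (polyadic_cyl_compl_of_fixed hy))
  simpa using this

end

theorem polyadic_cyl_diag {κ : Type w} {B : Type v} [BooleanAlgebra B]
    [PolyadicEqualityAlgebra κ B] {Γ : Set κ} {i j : κ} (hi : i ∉ Γ) (hj : j ∉ Γ) :
    cyl Γ (diag i j : B) = diag i j := by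
  classical
  let τ : κ → κ := fun k => if k ∈ Γ then i else k
  have hτ : τ ⁻¹' Γ = ∅ := by
    ext k
    by_cases hk : k ∈ Γ <;> simp [τ, hk, hi]
  have h : subst τ (diag i j : B) = diag i j := by
    rw [subst_diag]
    simp [τ, hj]
  conv_lhs => rw [← h]
  rw [cyl_subst _ _ _ (by simp [hτ]), hτ, cyl_empty, h]

section
variable {ι : Type u} {κ : Type w} (e : ι ↪ κ) (B : Type v) [BooleanAlgebra B]

/-- The carrier `{b ∈ B : c_(κ ∼ J) b = b}` of the `J`-compression of `B`, where `J ⊆ κ` is the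
copy of `ι` under `e`. -/
def neatReduct [PolyadicAlgebra κ B] : BooleanSubalgebra B where
  carrier := {b | cyl (range e)ᶜ b = b}
  supClosed' := fun _ ha _ hb => polyadic_cyl_sup_of_fixed ha hb
  infClosed' := fun _ ha _ hb => polyadic_cyl_inf_of_fixed ha hb
  compl_mem' := fun ha => polyadic_cyl_compl_of_fixed ha
  bot_mem' := cyl_bot _

variable {B} in
theorem mem_neatReduct [PolyadicAlgebra κ B] {b : B} :
    b ∈ neatReduct e B ↔ cyl (range e)ᶜ b = b := Iff.rfl

/-- The polyadic operations of the compression: `c_(Γ)` is computed in `B`, and the substitution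
of `τ` is `s_τ̄` of `B`, where `τ̄` extends `τ` by the identity. -/
noncomputable instance neatReduct.instPolyadicAlgebra [PolyadicAlgebra κ B] :
    PolyadicAlgebra ι (neatReduct e B) where
  cyl Γ x := ⟨cyl (e '' Γ) (x : B), by
    rw [mem_neatReduct, cyl_cyl, union_comm, ← cyl_cyl, (mem_neatReduct e).1 x.2]⟩
  subst τ x := ⟨subst (extendMap e τ) (x : B), by
    have hinj : InjOn (extendMap e τ) (extendMap e τ ⁻¹' (range e)ᶜ) := by
      rw [extendMap_preimage_compl]
      intro k hk l hl h
      rwa [extendMap_of_notMem e τ hk, extendMap_of_notMem e τ hl] at h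
    rw [mem_neatReduct, cyl_subst _ _ _ hinj, extendMap_preimage_compl,
      (mem_neatReduct e).1 x.2]⟩
  cyl_bot Γ := Subtype.ext (cyl_bot _)
  le_cyl Γ x := le_cyl (e '' Γ) (x : B)
  cyl_inf_cyl Γ x y := Subtype.ext (cyl_inf_cyl _ _ _)
  cyl_empty x := Subtype.ext (by simp [cyl_empty])
  cyl_cyl Γ Δ x := Subtype.ext (by simp [cyl_cyl, image_union])
  subst_sup τ x y := Subtype.ext (subst_sup _ _ _)
  subst_compl τ x := Subtype.ext (subst_compl _ _)
  subst_id x := Subtype.ext (by simp [extendMap_id, subst_id])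
  subst_comp σ τ x := Subtype.ext (by simp [extendMap_comp, subst_comp])
  subst_cyl_congr Γ σ τ x h := Subtype.ext (by
    refine subst_cyl_congr (A := B) (e '' Γ) _ _ (x : B) fun k hk => ?_
    by_cases hk' : k ∈ range e
    · obtain ⟨i, rfl⟩ := hk'
      rw [extendMap_apply, extendMap_apply, h i fun hi => hk (mem_image_of_mem _ hi)]
    · rw [extendMap_of_notMem e σ hk', extendMap_of_notMem e τ hk'])
  cyl_subst Γ τ x h := Subtype.ext (by
    have hinj : InjOn (extendMap e τ) (extendMap e τ ⁻¹' (e '' Γ)) := by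
      rw [extendMap_preimage_image]
      rintro _ ⟨i, hi, rfl⟩ _ ⟨j, hj, rfl⟩ hij
      rw [extendMap_apply, extendMap_apply] at hij
      rw [h hi hj (e.injective hij)]
    simp [cyl_subst _ _ _ hinj, extendMap_preimage_image])

/-- The compression of a polyadic equality algebra has the diagonal elements of `B` with indices
in `J`. -/
noncomputable instance neatReduct.instPolyadicEqualityAlgebra [PolyadicEqualityAlgebra κ B] :
    PolyadicEqualityAlgebra ι (neatReduct e B) where
  diag i j := ⟨diag (e i) (e j), polyadic_cyl_diag (by simp) (by simp)⟩
  diag_self i := Subtype.ext (diag_self _)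
  inf_diag_le i j x := by
    have h := inf_diag_le (e i) (e j) (x : B)
    rw [← extendMap_replacement] at h
    exact h
  subst_diag τ i j := Subtype.ext (by
    change subst (extendMap e τ) (diag (e i) (e j) : B) = diag (e (τ i)) (e (τ j))
    rw [subst_diag, extendMap_apply, extendMap_apply])

end

/-! ### Ordinal dimensions -/

/-- `PEA_α` for an ordinal `α`, the index set being the set of ordinals less than `α`. -/
abbrev PEA (α : Ordinal.{u}) (A : Type v) [BooleanAlgebra A] :=
  PolyadicEqualityAlgebra (Iio α) A

/-- The inclusion `α ⊆ β` for ordinals `α ≤ β`. -/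
def ordinalInclusion {α β : Ordinal.{u}} (h : α ≤ β) : Iio α ↪ Iio β :=
  embeddingOfSubset (Iio α) (Iio β) (Iio_subset_Iio h)

/-- The neat `α`-reduct of an algebra of dimension `β ≥ α`. -/
abbrev Nr {α β : Ordinal.{u}} (h : α ≤ β) (B : Type v) [BooleanAlgebra B] [PEA β B] :
    BooleanSubalgebra B :=
  neatReduct (ordinalInclusion h) B

end PolyadicDefinitions

/-! Everything in `B` is a translate `s_σ a` of an element of `A`, and since `α` is infinite, any
two maps `σ, τ : α → β` factor through one injection `ρ : α → β`, as `σ = ρ ∘ σ'` and `τ = ρ ∘ τ'`.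
Hence any two translates can be written as `s_ρ a` and `s_ρ b` with the same injective `ρ`, where
all operations are forced: `s_ρ` is a Boolean homomorphism, `c_(Γ) s_ρ a = s_ρ c_(ρ⁻¹Γ) a`,
`s_τ s_ρ a = s_{τρ} a`, `d_{ρ(k)ρ(l)} = s_ρ d_kl`.

For existence, `s_σ a` is realised as the family `(s_{θσ} a)_θ` over all `θ : β → α`; evaluating at
a left inverse of `ρ` shows that `s_ρ` is injective, so the forced cylindrifications are well
defined. For ideals, a left inverse of `ρ` recovers `a` from `s_ρ a`, so an ideal contains `s_ρ a`
exactly when it contains `a`.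
-/

open PolyadicAlgebra PolyadicEqualityAlgebra

section Embeddings
open Cardinal
variable {ι : Type u} {κ : Type w} [Infinite ι]

theorem exists_embedding_range_subset {γ : Type u} (hγ : #γ ≤ #ι) (e : ι ↪ κ) (g : γ → κ) :
    ∃ ρ : ι ↪ κ, range g ⊆ range ρ := by
  have hle : lift.{u} #(range (Sum.elim g e)) ≤ lift.{w} #ι := by
    refine mk_range_le_lift.trans (lift_le.2 ?_)
    rw [mk_sum, lift_id, lift_id]
    exact add_le_of_le (aleph0_le_mk ι) hγ le_rfl
  have hge : lift.{w} #ι ≤ lift.{u} #(range (Sum.elim g e)) :=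
    lift_mk_le'.2 ⟨e.codRestrict _ fun i => ⟨Sum.inr i, rfl⟩⟩
  obtain ⟨ψ⟩ := lift_mk_eq'.1 (hge.antisymm hle)
  refine ⟨ψ.toEmbedding.trans (Embedding.subtype _), ?_⟩
  rintro _ ⟨c, rfl⟩
  exact ⟨ψ.symm ⟨g c, Sum.inl c, rfl⟩, congrArg Subtype.val (ψ.apply_symm_apply _)⟩

theorem exists_embedding_factor (e : ι ↪ κ) (σ τ : ι → κ) :
    ∃ (ρ : ι ↪ κ) (σ' τ' : ι → ι), ρ ∘ σ' = σ ∧ ρ ∘ τ' = τ := by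
  obtain ⟨ρ, hρ⟩ := exists_embedding_range_subset
    (by rw [mk_sum, lift_id, add_eq_self (aleph0_le_mk ι)]) e (Sum.elim σ τ)
  rw [Sum.elim_range, union_subset_iff, range_subset_range_iff_exists_comp,
    range_subset_range_iff_exists_comp] at hρ
  obtain ⟨⟨σ', hσ⟩, τ', hτ⟩ := hρ
  exact ⟨ρ, σ', τ', hσ.symm, hτ.symm⟩

theorem exists_embedding_factor_pair (e : ι ↪ κ) (σ : ι → κ) (p q : κ) :
    ∃ (ρ : ι ↪ κ) (σ' : ι → ι) (k l : ι), ρ ∘ σ' = σ ∧ ρ k = p ∧ ρ l = q := by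
  classical
  obtain ⟨i, j, hij⟩ := exists_pair_ne ι
  obtain ⟨ρ, σ', τ, hσ, hτ⟩ := exists_embedding_factor e σ fun k => if k = i then p else q
  exact ⟨ρ, σ', τ i, τ j, hσ, by simpa using congrFun hτ i,
    by simpa [hij.symm] using congrFun hτ j⟩

end Embeddings

section SubstHom
variable {ι : Type u} {A : Type v} [BooleanAlgebra A] [PolyadicAlgebra ι A]

theorem polyadic_subst_inf (τ : ι → ι) (x y : A) :
    subst τ (x ⊓ y) = subst τ x ⊓ subst τ y := by
  rw [← compl_inj_iff, ← subst_compl, compl_inf, subst_sup, subst_compl, subst_compl, compl_inf]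

theorem polyadic_subst_bot (τ : ι → ι) : subst τ (⊥ : A) = ⊥ := by
  have h := polyadic_subst_inf τ (⊥ : A) ⊥ᶜ
  rwa [subst_compl, inf_compl_self, inf_compl_self] at h

/-- The substitution `s_τ` as a Boolean endomorphism. -/
def substHom (τ : ι → ι) : BoundedLatticeHom A A where
  toFun := subst τ
  map_sup' := subst_sup τ
  map_inf' := polyadic_subst_inf τ
  map_top' := by rw [← compl_bot, subst_compl, polyadic_subst_bot, compl_bot]
  map_bot' := polyadic_subst_bot τ

end SubstHom

/-- A system of translates `s_σ a ∈ B` of the elements `a` of an `ι`-dimensional algebra `A` along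
the maps `σ : ι → κ`: each `s_σ` is a Boolean homomorphism, and `s_σ s_τ a = s_{στ} a` for the
substitutions `s_τ` of `A`. The codomain `B` is only a Boolean algebra, so that the notion is
available before the polyadic operations of a dilation are defined. -/
structure TranslateSystem (ι : Type*) (κ : Type*) (A : Type*) (B : Type*)
    [BooleanAlgebra A] [PolyadicAlgebra ι A] [BooleanAlgebra B] where
  /-- the homomorphism `s_σ` -/
  hom : (ι → κ) → BoundedLatticeHom A B
  apply_comp : ∀ (σ : ι → κ) (τ : ι → ι) (a : A), hom (σ ∘ τ) a = hom σ (subst τ a)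

namespace TranslateSystem

section
variable {ι κ A B : Type*} [BooleanAlgebra A] [PolyadicAlgebra ι A] [BooleanAlgebra B]

instance : CoeFun (TranslateSystem ι κ A B) fun _ => (ι → κ) → BoundedLatticeHom A B where
  coe := hom

theorem apply_comp_cyl_preimage (S : TranslateSystem ι κ A B) (σ : ι → κ) {τ : ι → ι}
    {Γ : Set κ} (hτ : InjOn τ (σ ∘ τ ⁻¹' Γ)) (a : A) :
    S (σ ∘ τ) (cyl (σ ∘ τ ⁻¹' Γ) a) = S σ (cyl (σ ⁻¹' Γ) (subst τ a)) := by
  rw [preimage_comp] at hτ ⊢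
  rw [S.apply_comp, cyl_subst _ _ _ hτ]

end

variable {ι : Type u} {κ : Type w} {A B : Type*} [BooleanAlgebra A] [PolyadicAlgebra ι A]
  [BooleanAlgebra B] [Infinite ι] (S : TranslateSystem ι κ A B) (e : ι ↪ κ)

include e

theorem exists_embedding_apply_eq (σ : ι → κ) (a : A) :
    ∃ (ρ : ι ↪ κ) (a' : A), S ρ a' = S σ a := by
  obtain ⟨ρ, σ', -, rfl, -⟩ := exists_embedding_factor e σ e
  exact ⟨ρ, subst σ' a, (S.apply_comp ρ σ' a).symm⟩

theorem exists_embedding_apply_eq₂ (σ τ : ι → κ) (a b : A) :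
    ∃ (ρ : ι ↪ κ) (a' b' : A), S ρ a' = S σ a ∧ S ρ b' = S τ b := by
  obtain ⟨ρ, σ', τ', rfl, rfl⟩ := exists_embedding_factor e σ τ
  exact ⟨ρ, subst σ' a, subst τ' b, (S.apply_comp ρ σ' a).symm, (S.apply_comp ρ τ' b).symm⟩

theorem apply_cyl_congr {σ τ : ι → κ} {Γ : Set ι} (h : ∀ i, i ∉ Γ → σ i = τ i) (a : A) :
    S σ (cyl Γ a) = S τ (cyl Γ a) := by
  obtain ⟨ρ, σ', τ', rfl, rfl⟩ := exists_embedding_factor e σ τ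
  rw [S.apply_comp, S.apply_comp,
    subst_cyl_congr Γ σ' τ' a fun i hi => ρ.injective (h i hi)]

theorem apply_cyl_preimage_congr (hS : ∀ ρ : ι ↪ κ, Injective (S ρ)) {ρ π : ι ↪ κ} {a b : A}
    (h : S ρ a = S π b) (Γ : Set κ) :
    S ρ (cyl (ρ ⁻¹' Γ) a) = S π (cyl (π ⁻¹' Γ) b) := by
  obtain ⟨θ, ρ', π', hρ, hπ⟩ := exists_embedding_factor e ρ π
  have hρ' : Injective ρ' := .of_comp (hρ ▸ ρ.injective)
  have hπ' : Injective π' := .of_comp (hπ ▸ π.injective)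
  rw [← hρ, ← hπ, S.apply_comp, S.apply_comp] at h
  rw [← hρ, ← hπ, S.apply_comp_cyl_preimage _ hρ'.injOn, S.apply_comp_cyl_preimage _ hπ'.injOn,
    hS θ h]

/-- The Boolean subalgebra of all translates. -/
def span : BooleanSubalgebra B where
  carrier := {b | ∃ (σ : ι → κ) (a : A), S σ a = b}
  supClosed' := by
    rintro _ ⟨σ, a, rfl⟩ _ ⟨τ, b, rfl⟩
    obtain ⟨ρ, a', b', ha, hb⟩ := S.exists_embedding_apply_eq₂ e σ τ a b
    exact ⟨ρ, a' ⊔ b', by rw [map_sup, ha, hb]⟩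
  infClosed' := by
    rintro _ ⟨σ, a, rfl⟩ _ ⟨τ, b, rfl⟩
    obtain ⟨ρ, a', b', ha, hb⟩ := S.exists_embedding_apply_eq₂ e σ τ a b
    exact ⟨ρ, a' ⊓ b', by rw [map_inf, ha, hb]⟩
  compl_mem' := by
    rintro _ ⟨σ, a, rfl⟩
    exact ⟨σ, aᶜ, map_compl' _ a⟩
  bot_mem' := ⟨e, ⊥, map_bot _⟩

/-- The same system of translates, with values in the subalgebra of all translates. -/
def toSpan : TranslateSystem ι κ A (S.span e) where
  hom σ :=
    { toFun := fun a => ⟨S σ a, σ, a, rfl⟩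
      map_sup' := fun a b => Subtype.ext (map_sup (S σ) a b)
      map_inf' := fun a b => Subtype.ext (map_inf (S σ) a b)
      map_top' := Subtype.ext (map_top (S σ))
      map_bot' := Subtype.ext (map_bot (S σ)) }
  apply_comp σ τ a := Subtype.ext (S.apply_comp σ τ a)

end TranslateSystem

section Dilation
variable {ι : Type u} {κ : Type w} {A : Type v} [BooleanAlgebra A]

variable (ι κ A) in
/-- The translates `s_σ a` encoded by their images `s_{θσ} a` under all `θ : κ → ι`. -/
def TranslateSystem.pointwise [PolyadicAlgebra ι A] : TranslateSystem ι κ A ((κ → ι) → A) where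
  hom σ :=
    { toFun := fun a θ => substHom (θ ∘ σ) a
      map_sup' := fun a b => funext fun θ => map_sup (substHom (θ ∘ σ)) a b
      map_inf' := fun a b => funext fun θ => map_inf (substHom (θ ∘ σ)) a b
      map_top' := funext fun θ => map_top (substHom (θ ∘ σ))
      map_bot' := funext fun θ => map_bot (substHom (θ ∘ σ)) }
  apply_comp σ τ a := funext fun θ => subst_comp (θ ∘ σ) τ a

variable (A) in
/-- The dilation of an `ι`-dimensional algebra along an embedding `e : ι ↪ κ`: the `κ`-dimensional
algebra consisting of all translates `s_σ a`. Its universe does not depend on `e`. -/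
def dilation [PolyadicAlgebra ι A] [Infinite ι] (e : ι ↪ κ) : BooleanSubalgebra ((κ → ι) → A) :=
  (TranslateSystem.pointwise ι κ A).span e

namespace dilation
variable [Infinite ι] (e : ι ↪ κ)

section
variable [PolyadicAlgebra ι A]

variable (A) in
/-- The translates `s_σ a` as elements of the dilation. -/
def translate : TranslateSystem ι κ A (dilation A e) := (TranslateSystem.pointwise ι κ A).toSpan e

theorem exists_translate_eq (x : dilation A e) : ∃ (ρ : ι ↪ κ) (a : A), translate A e ρ a = x := by
  obtain ⟨_, σ, a, rfl⟩ := x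
  exact (translate A e).exists_embedding_apply_eq e σ a

theorem exists_translate_eq₂ (x y : dilation A e) :
    ∃ (ρ : ι ↪ κ) (a b : A), translate A e ρ a = x ∧ translate A e ρ b = y := by
  obtain ⟨_, σ, a, rfl⟩ := x
  obtain ⟨_, τ, b, rfl⟩ := y
  exact (translate A e).exists_embedding_apply_eq₂ e σ τ a b

theorem translate_injective (ρ : ι ↪ κ) : Injective (translate A e ρ) := by
  intro a b h
  have heval : subst (invFun ρ ∘ ρ) a = subst (invFun ρ ∘ ρ) b :=
    congrFun (congrArg Subtype.val h) (invFun ρ)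
  rwa [invFun_comp ρ.injective, subst_id, subst_id] at heval

/-- The cylindrification `c_(Γ)` of the dilation, defined by `c_(Γ) s_ρ a = s_ρ c_(ρ⁻¹Γ) a` for an
arbitrary choice of an embedding `ρ`. -/
noncomputable def cylinder (Γ : Set κ) (x : dilation A e) : dilation A e :=
  let ρ := (exists_translate_eq e x).choose
  translate A e ρ (cyl (ρ ⁻¹' Γ) (exists_translate_eq e x).choose_spec.choose)

theorem cylinder_translate (Γ : Set κ) (ρ : ι ↪ κ) (a : A) :
    cylinder e Γ (translate A e ρ a) = translate A e ρ (cyl (ρ ⁻¹' Γ) a) :=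
  (translate A e).apply_cyl_preimage_congr e (translate_injective e)
    (exists_translate_eq e (translate A e ρ a)).choose_spec.choose_spec Γ

/-- The substitution `s_τ` of the dilation. -/
def substitution (τ : κ → κ) (x : dilation A e) : dilation A e :=
  ⟨fun θ => x.1 (θ ∘ τ), by
    obtain ⟨_, σ, a, rfl⟩ := x
    exact ⟨τ ∘ σ, a, rfl⟩⟩

theorem substitution_translate (τ : κ → κ) (σ : ι → κ) (a : A) :
    substitution e τ (translate A e σ a) = translate A e (τ ∘ σ) a := rfl

theorem cylinder_substitution {Γ : Set κ} {τ : κ → κ} (hτ : InjOn τ (τ ⁻¹' Γ))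
    (x : dilation A e) :
    cylinder e Γ (substitution e τ x) = substitution e τ (cylinder e (τ ⁻¹' Γ) x) := by
  obtain ⟨ρ, a, rfl⟩ := exists_translate_eq e x
  obtain ⟨π, τ', -, hπ, -⟩ := exists_embedding_factor e (τ ∘ ρ) e
  have hinj : InjOn τ' (π ∘ τ' ⁻¹' Γ) := by
    have hcomp : InjOn (τ ∘ ρ) (τ ∘ ρ ⁻¹' Γ) :=
      hτ.comp ρ.injective.injOn (mapsTo_preimage ρ (τ ⁻¹' Γ))
    rw [← hπ] at hcomp
    exact hcomp.of_comp
  calc cylinder e Γ (substitution e τ (translate A e ρ a))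
      = cylinder e Γ (translate A e π (subst τ' a)) := by
        rw [substitution_translate, ← hπ, (translate A e).apply_comp]
    _ = translate A e (π ∘ τ') (cyl (π ∘ τ' ⁻¹' Γ) a) := by
        rw [cylinder_translate, (translate A e).apply_comp_cyl_preimage _ hinj]
    _ = substitution e τ (cylinder e (τ ⁻¹' Γ) (translate A e ρ a)) := by
        rw [cylinder_translate, substitution_translate, hπ, preimage_comp]

noncomputable instance instPolyadicAlgebra : PolyadicAlgebra κ (dilation A e) where
  cyl := cylinder e
  subst := substitution e
  cyl_bot Γ := by rw [← map_bot (translate A e e), cylinder_translate, cyl_bot]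
  le_cyl Γ x := by
    obtain ⟨ρ, a, rfl⟩ := exists_translate_eq e x
    rw [cylinder_translate]
    exact OrderHomClass.mono (translate A e ρ) (le_cyl _ a)
  cyl_inf_cyl Γ x y := by
    obtain ⟨ρ, a, b, rfl, rfl⟩ := exists_translate_eq₂ e x y
    simp only [cylinder_translate, ← map_inf, cyl_inf_cyl]
  cyl_empty x := by
    obtain ⟨ρ, a, rfl⟩ := exists_translate_eq e x
    rw [cylinder_translate, preimage_empty, cyl_empty]
  cyl_cyl Γ Δ x := by
    obtain ⟨ρ, a, rfl⟩ := exists_translate_eq e x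
    simp only [cylinder_translate, cyl_cyl, preimage_union]
  subst_sup _ _ _ := rfl
  subst_compl _ _ := rfl
  subst_id _ := rfl
  subst_comp _ _ _ := rfl
  subst_cyl_congr Γ σ τ x h := by
    obtain ⟨ρ, a, rfl⟩ := exists_translate_eq e x
    rw [cylinder_translate, substitution_translate, substitution_translate]
    exact (translate A e).apply_cyl_congr e (fun i hi => h (ρ i) hi) a
  cyl_subst _ _ x h := cylinder_substitution e h x

theorem cyl_translate (Γ : Set κ) (ρ : ι ↪ κ) (a : A) :
    cyl Γ (translate A e ρ a) = translate A e ρ (cyl (ρ ⁻¹' Γ) a) :=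
  cylinder_translate e Γ ρ a

theorem subst_translate (τ : κ → κ) (σ : ι → κ) (a : A) :
    subst τ (translate A e σ a) = translate A e (τ ∘ σ) a := rfl

end

variable [PolyadicEqualityAlgebra ι A]

/-- The diagonal element `d_pq` of the dilation. -/
def diagonal (p q : κ) : dilation A e :=
  ⟨fun θ => diag (θ p) (θ q), by
    obtain ⟨ρ, -, k, l, -, rfl, rfl⟩ := exists_embedding_factor_pair e e p q
    exact ⟨ρ, diag k l, funext fun θ => subst_diag (θ ∘ ρ) k l⟩⟩

theorem translate_diag (σ : ι → κ) (k l : ι) :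
    translate A e σ (diag k l) = diagonal e (σ k) (σ l) :=
  Subtype.ext (funext fun θ => subst_diag (θ ∘ σ) k l)

noncomputable instance instPolyadicEqualityAlgebra :
    PolyadicEqualityAlgebra κ (dilation A e) where
  diag := diagonal e
  diag_self p := Subtype.ext (funext fun θ => diag_self (θ p))
  inf_diag_le p q x := by
    obtain ⟨σ, a, rfl⟩ := exists_translate_eq e x
    obtain ⟨ρ, σ', k, l, hσ, rfl, rfl⟩ := exists_embedding_factor_pair e σ p q
    have hreplacement : replacement (ρ k) (ρ l) ∘ ρ = ρ ∘ replacement k l := by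
      rw [← extendMap_replacement]
      exact funext (extendMap_apply ρ _)
    rw [← hσ, (translate A e).apply_comp, ← translate_diag, subst_translate, hreplacement,
      (translate A e).apply_comp, ← map_inf]
    exact OrderHomClass.mono (translate A e ρ) (inf_diag_le k l _)
  subst_diag _ _ _ := rfl

variable (A) in
/-- The canonical map `a ↦ s_e a` of an algebra into the compression of its dilation. -/
noncomputable def embed : PolyadicEqualityHom ι A (neatReduct e (dilation A e)) where
  toFun a := ⟨translate A e e a, by
    rw [mem_neatReduct, cyl_translate, preimage_compl, preimage_range, compl_univ, cyl_empty]⟩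
  map_sup' a b := Subtype.ext (map_sup (translate A e e) a b)
  map_inf' a b := Subtype.ext (map_inf (translate A e e) a b)
  map_top' := Subtype.ext (map_top (translate A e e))
  map_bot' := Subtype.ext (map_bot (translate A e e))
  map_cyl Γ a := Subtype.ext <|
    calc translate A e e (cyl Γ a)
        = translate A e e (cyl (e ⁻¹' (e '' Γ)) a) := by rw [preimage_image_eq _ e.injective]
      _ = cyl (e '' Γ) (translate A e e a) := (cyl_translate e _ e a).symm
  map_subst τ a := Subtype.ext <|
    calc translate A e e (subst τ a)
        = translate A e (e ∘ τ) a := ((translate A e).apply_comp e τ a).symm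
      _ = translate A e (extendMap e τ ∘ e) a := by
        rw [show extendMap e τ ∘ e = e ∘ τ from funext (extendMap_apply e τ)]
  map_diag i j := Subtype.ext (translate_diag e e i j)

theorem embed_injective : Injective (embed A e) := fun _ _ h =>
  translate_injective e e (congrArg Subtype.val h)

theorem exists_subst_embed_eq (x : dilation A e) :
    ∃ (a : A) (σ : κ → κ), InjOn σ (range e) ∧ x = subst σ (embed A e a : dilation A e) := by
  obtain ⟨ρ, a, rfl⟩ := exists_translate_eq e x
  have hρ : extend e ρ id ∘ e = ρ := extend_comp e.injective _ _
  refine ⟨a, extend e ρ id, Injective.injOn_range (by rw [hρ]; exact ρ.injective), ?_⟩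
  calc translate A e ρ a
      = translate A e (extend e ρ id ∘ e) a := by rw [hρ]
    _ = subst (extend e ρ id) (translate A e e a) := (subst_translate e _ e a).symm

end dilation

end Dilation

namespace neatReduct
variable {ι : Type u} {κ : Type*} {B : Type w} [BooleanAlgebra B]

section
variable [PolyadicAlgebra κ B] {e : ι ↪ κ}

theorem subst_congr {σ τ : κ → κ} (h : σ ∘ e = τ ∘ e) (x : neatReduct e B) :
    subst σ (x : B) = subst τ (x : B) := by
  rw [← (mem_neatReduct e).1 x.2]
  refine subst_cyl_congr _ _ _ _ fun k hk => ?_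
  obtain ⟨i, rfl⟩ := not_notMem.1 hk
  exact congrFun h i

variable (B e) in
/-- The translates `s_σ x` of the elements of a compression of `B`, computed in `B` as `s_σ̄ x` for
an extension `σ̄ : κ → κ` of `σ : ι → κ`; `subst_congr` says that all extensions agree on `x`. -/
noncomputable def translate : TranslateSystem ι κ (neatReduct e B) B where
  hom σ := (substHom (extend e σ id)).comp (neatReduct e B).subtype
  apply_comp σ τ x := by
    change subst _ (x : B) = subst _ (subst (extendMap e τ) (x : B))
    rw [← subst_comp]
    refine subst_congr (funext fun i => ?_) x
    simp only [comp_apply, extendMap_apply, e.injective.extend_apply]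

theorem subst_eq_translate {σ : κ → κ} {ρ : ι → κ} (h : σ ∘ e = ρ) (x : neatReduct e B) :
    subst σ (x : B) = translate B e ρ x :=
  subst_congr (h.trans (extend_comp e.injective _ _).symm) x

theorem translate_self (x : neatReduct e B) : translate B e e x = x := by
  rw [← subst_eq_translate (id_comp _), subst_id]

theorem subst_translate (τ : κ → κ) (ρ : ι → κ) (x : neatReduct e B) :
    subst τ (translate B e ρ x) = translate B e (τ ∘ ρ) x := by
  have hρ : extend e ρ id ∘ e = ρ := extend_comp e.injective _ _
  rw [← subst_eq_translate hρ, ← subst_comp, subst_eq_translate]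
  rw [comp_assoc, hρ]

theorem cyl_translate_of_notMem (ρ : ι ↪ κ) {Γ : Set κ} {k : κ} (hk : k ∉ Γ)
    (x : neatReduct e B) :
    cyl Γ (translate B e ρ x) = translate B e ρ (cyl (ρ ⁻¹' Γ) x) := by
  -- Everything outside `range e` goes to `k ∉ Γ`, so that `σ ⁻¹' Γ` lies in `range e`.
  let σ : κ → κ := extend e ρ fun _ => k
  have hσ : σ ∘ e = ρ := extend_comp e.injective _ _
  have hrange : σ ⁻¹' Γ ⊆ range e := fun j hj => by
    by_contra hje
    exact hk (extend_apply' ρ (fun _ => k) j hje ▸ hj)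
  have hpre : σ ⁻¹' Γ = e '' (ρ ⁻¹' Γ) := by
    rw [← hσ, preimage_comp, image_preimage_eq_of_subset hrange]
  have hinj : InjOn σ (σ ⁻¹' Γ) :=
    (Injective.injOn_range (hσ ▸ ρ.injective)).mono hrange
  calc cyl Γ (translate B e ρ x)
      = subst σ (cyl (e '' (ρ ⁻¹' Γ)) (x : B)) := by
        rw [← subst_eq_translate hσ, cyl_subst _ _ _ hinj, hpre]
    _ = translate B e ρ (cyl (ρ ⁻¹' Γ) x) := subst_eq_translate hσ (cyl (ρ ⁻¹' Γ) x)

theorem cyl_translate [Nontrivial κ] (ρ : ι ↪ κ) (Γ : Set κ) (x : neatReduct e B) :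
    cyl Γ (translate B e ρ x) = translate B e ρ (cyl (ρ ⁻¹' Γ) x) := by
  by_cases hΓ : ∃ k, k ∉ Γ
  · obtain ⟨k, hk⟩ := hΓ
    exact cyl_translate_of_notMem ρ hk x
  · obtain ⟨p, q, hpq⟩ := exists_pair_ne κ
    have hp : p ∉ ({p}ᶜ : Set κ) := not_not.2 rfl
    have hq : q ∉ ({p} : Set κ) := hpq.symm
    have hunion : Γ = {p}ᶜ ∪ {p} := by
      rw [compl_union_self, eq_univ_iff_forall]
      simpa only [not_exists, not_not] using hΓ
    rw [hunion, ← cyl_cyl, cyl_translate_of_notMem ρ hq, cyl_translate_of_notMem ρ hp, cyl_cyl,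
      preimage_union]

theorem coe_mem_of_translate_mem [Nonempty ι] {I : Order.Ideal B} (hI : IsPolyadicIdeal κ I)
    {ρ : ι ↪ κ} {x : neatReduct e B} (h : translate B e ρ x ∈ I) : (x : B) ∈ I := by
  have hmem := hI.subst_mem (e ∘ invFun ρ) _ h
  rwa [subst_translate, comp_assoc, invFun_comp ρ.injective, comp_id, translate_self] at hmem

end

theorem translate_diag [PolyadicEqualityAlgebra κ B] {e : ι ↪ κ} (ρ : ι → κ) (k l : ι) :
    translate B e ρ (diag k l) = diag (ρ k) (ρ l) := by
  change subst _ (diag (e k) (e l) : B) = _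
  rw [subst_diag, e.injective.extend_apply, e.injective.extend_apply]

end neatReduct

/-- The preimage of an ideal under a homomorphism of bounded join semilattices. -/
def idealComap {P Q F : Type*} [SemilatticeSup P] [OrderBot P] [SemilatticeSup Q] [OrderBot Q]
    [FunLike F P Q] [SupBotHomClass F P Q] (f : F) (I : Order.Ideal Q) : Order.Ideal P where
  carrier := f ⁻¹' I
  lower' _ _ h ha := I.lower (OrderHomClass.mono f h) ha
  nonempty' := ⟨⊥, by simp only [mem_preimage, map_bot, SetLike.mem_coe, I.bot_mem]⟩
  directed' a ha b hb := ⟨a ⊔ b, by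
    rw [mem_preimage, map_sup]
    exact I.sup_mem ha hb, le_sup_left, le_sup_right⟩

namespace PolyadicEqualityHom
variable {ι : Type u} {κ : Type*} {A : Type v} {B : Type w} [BooleanAlgebra A] [BooleanAlgebra B]
  [PolyadicEqualityAlgebra ι A] [PolyadicEqualityAlgebra κ B] {e : ι ↪ κ}
  (f : PolyadicEqualityHom ι A (neatReduct e B))

/-- The translates in `B` of the elements of `A`, for a homomorphism from `A` to a compression
of `B`. -/
noncomputable def translate : TranslateSystem ι κ A B where
  hom σ := (neatReduct.translate B e σ).comp f.toBoundedLatticeHom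
  apply_comp σ τ a := ((neatReduct.translate B e).apply_comp σ τ (f a)).trans
    (congrArg (neatReduct.translate B e σ) (f.map_subst τ a).symm)

theorem cyl_translate [Nontrivial κ] (ρ : ι ↪ κ) (Γ : Set κ) (a : A) :
    cyl Γ (f.translate ρ a) = f.translate ρ (cyl (ρ ⁻¹' Γ) a) :=
  (neatReduct.cyl_translate ρ Γ (f a)).trans
    (congrArg (neatReduct.translate B e ρ) (f.map_cyl _ a).symm)

theorem translate_diag (σ : ι → κ) (k l : ι) : f.translate σ (diag k l) = diag (σ k) (σ l) :=
  (congrArg (neatReduct.translate B e σ) (f.map_diag k l)).trans (neatReduct.translate_diag σ k l)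

theorem isPolyadicEqualitySubalgebra_span_translate [Infinite ι] :
    IsPolyadicEqualitySubalgebra κ (f.translate.span e) where
  cyl_mem Γ _ := by
    rintro ⟨σ, a, rfl⟩
    have : Nontrivial κ := e.injective.nontrivial
    obtain ⟨ρ, b, hb⟩ := f.translate.exists_embedding_apply_eq e σ a
    exact ⟨ρ, cyl (ρ ⁻¹' Γ) b, by rw [← f.cyl_translate, hb]⟩
  subst_mem τ _ := by
    rintro ⟨σ, a, rfl⟩
    exact ⟨τ ∘ σ, a, (neatReduct.subst_translate τ σ (f a)).symm⟩
  diag_mem p q := by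
    obtain ⟨ρ, -, k, l, -, rfl, rfl⟩ := exists_embedding_factor_pair e e p q
    exact ⟨ρ, diag k l, f.translate_diag ρ k l⟩

theorem isPolyadicIdeal_comap {I : Order.Ideal B} (hI : IsPolyadicIdeal κ I) :
    IsPolyadicIdeal ι (idealComap ((neatReduct e B).subtype.comp f.toBoundedLatticeHom) I) where
  cyl_mem Γ a ha := by
    have hcyl : (f (cyl Γ a) : B) = cyl (e '' Γ) (f a : B) := congrArg Subtype.val (f.map_cyl Γ a)
    exact (congrArg (· ∈ I) hcyl).mpr (hI.cyl_mem _ _ ha)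
  subst_mem τ a ha := by
    have hsubst : (f (subst τ a) : B) = subst (extendMap e τ) (f a : B) :=
      congrArg Subtype.val (f.map_subst τ a)
    exact (congrArg (· ∈ I) hsubst).mpr (hI.subst_mem _ _ ha)

variable {f} [Infinite ι]

theorem exists_translate_eq (hf : PolyadicGenerates κ (range fun a : A => (f a : B))) (b : B) :
    ∃ (ρ : ι ↪ κ) (a : A), f.translate ρ a = b := by
  have hsub : (range fun a : A => (f a : B)) ⊆ f.translate.span e := by
    rintro _ ⟨a, rfl⟩
    exact ⟨e, a, neatReduct.translate_self (f a)⟩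
  obtain ⟨σ, a, rfl⟩ := hf _ f.isPolyadicEqualitySubalgebra_span_translate hsub b
  exact f.translate.exists_embedding_apply_eq e σ a

theorem eq_polyadicIdealGenerated (hf : PolyadicGenerates κ (range fun a : A => (f a : B)))
    {I : Order.Ideal B} (hI : IsPolyadicIdeal κ I) :
    I = polyadicIdealGenerated κ ((I : Set B) ∩ range fun a : A => (f a : B)) := by
  refine le_antisymm (fun b hb => ?_) (sInf_le ⟨hI, inter_subset_left⟩)
  refine Order.Ideal.mem_sInf.2 fun J ⟨hJ, hIJ⟩ => ?_
  obtain ⟨ρ, a, rfl⟩ := exists_translate_eq hf b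
  have ha : (f a : B) ∈ I := neatReduct.coe_mem_of_translate_mem hI hb
  exact hJ.subst_mem _ _ (hIJ ⟨ha, a, rfl⟩)

theorem isPolyadicSimple_of_generates (hinj : Injective f)
    (hf : PolyadicGenerates κ (range fun a : A => (f a : B))) (hA : IsPolyadicSimple ι A) :
    IsPolyadicSimple κ B := by
  obtain ⟨_, hideal⟩ := hA
  refine ⟨(Subtype.val_injective.comp hinj).nontrivial, fun I hI => ?_⟩
  rcases hideal _ (f.isPolyadicIdeal_comap hI) with hbot | htop
  · refine Or.inl (eq_bot_iff.2 fun b hb => ?_)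
    obtain ⟨ρ, a, rfl⟩ := exists_translate_eq hf b
    have ha : a ∈ (⊥ : Order.Ideal A) :=
      hbot ▸ (neatReduct.coe_mem_of_translate_mem hI hb : (f a : B) ∈ I)
    have ha' : a = ⊥ := le_bot_iff.1 ha
    rw [ha', map_bot]
    exact Order.Ideal.bot_mem _
  · have ha : (f ⊤ : B) ∈ I := (SetLike.ext_iff.1 htop ⊤).2 trivial
    refine Or.inr (Order.Ideal.top_of_top_mem ?_)
    rwa [show f ⊤ = ⊤ from f.map_top'] at ha

end PolyadicEqualityHom

theorem mainTheorem3_general {ι : Type u} {κ : Type w} [Infinite ι] (e : ι ↪ κ) (A : Type v)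
    [BooleanAlgebra A] [PolyadicEqualityAlgebra ι A] :
    (∃ (B : Type (max u v w)) (_ : BooleanAlgebra B) (_ : PolyadicEqualityAlgebra κ B)
        (f : PolyadicEqualityHom ι A (neatReduct e B)),
        Injective f ∧
        ∀ b : B, ∃ (a : A) (σ : κ → κ),
          InjOn σ (range e) ∧ b = PolyadicAlgebra.subst σ (f a : B)) ∧
    (∀ (B : Type*) [BooleanAlgebra B] [PolyadicEqualityAlgebra κ B]
        (f : PolyadicEqualityHom ι A (neatReduct e B)),
        PolyadicGenerates κ (range fun a : A => (f a : B)) →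
        (Injective f → IsPolyadicSimple ι A → IsPolyadicSimple κ B) ∧
        ∀ I : Order.Ideal B, IsPolyadicIdeal κ I →
          I = polyadicIdealGenerated κ ((I : Set B) ∩ range fun a : A => (f a : B))) :=
  ⟨⟨dilation A e, inferInstance, inferInstance, dilation.embed A e, dilation.embed_injective e,
      dilation.exists_subst_embed_eq e⟩,
    fun _ _ _ _ hf => ⟨fun hinj => PolyadicEqualityHom.isPolyadicSimple_of_generates hinj hf,
      fun _ => PolyadicEqualityHom.eq_polyadicIdealGenerated hf⟩⟩

theorem infinite_Iio_of_omega0_le {α : Ordinal.{u}} (hα : ω ≤ α) : Infinite (Iio α) := by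
  rw [Cardinal.infinite_iff, Cardinal.mk_Iio_ordinal, Cardinal.aleph0_le_lift,
    Ordinal.aleph0_le_card]
  exact hα

theorem range_ordinalInclusion {α β : Ordinal.{u}} (h : α ≤ β) :
    range (ordinalInclusion h) = {i : Iio β | (i : Ordinal.{u}) < α} :=
  range_inclusion (Iio_subset_Iio h)

theorem mainTheorem3 (α β : Ordinal.{u}) (hα : ω ≤ α) (hαβ : α < β)
    (A : Type v) [BooleanAlgebra A] [PEA α A] :
    (∃ (B : Type (max (u + 1) v)) (_ : BooleanAlgebra B) (_ : PEA β B)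
        (f : PolyadicEqualityHom (Iio α) A (Nr hαβ.le B)),
        Injective f ∧
        ∀ b : B, ∃ (a : A) (σ : Iio β → Iio β),
          InjOn σ {i : Iio β | (i : Ordinal.{u}) < α} ∧
          b = PolyadicAlgebra.subst σ (f a : B)) ∧
    (∀ (B : Type w) [BooleanAlgebra B] [PEA β B]
        (f : PolyadicEqualityHom (Iio α) A (Nr hαβ.le B)),
        Injective f →
        PolyadicGenerates (Iio β) (range fun a : A => (f a : B)) →
        (IsPolyadicSimple (Iio α) A → IsPolyadicSimple (Iio β) B) ∧
        ∀ I : Order.Ideal B, IsPolyadicIdeal (Iio β) I →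
          I = polyadicIdealGenerated (Iio β) ((I : Set B) ∩ range fun a : A => (f a : B))) := by
  have := infinite_Iio_of_omega0_le hα
  rw [← range_ordinalInclusion hαβ.le]
  exact (mainTheorem3_general _ A).imp_right fun h B _ _ f hinj hf =>
    (h B f hf).imp_left fun hsimple => hsimple hinj
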